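/- Let $\mathcal F^2$ be the Fock space of entire functions $f$ with $\frac1\pi\int_{\mathbb C}|f(z)|^2e^{-|z|^2}\,dV(z)<\infty$ ($dV$ is Lebesgue measure on $\mathbb C$), with the inner product $\langle f,g\rangle=\frac1\pi\int_{\mathbb C}f(z)\overline{g(z)}e^{-|z|^2}\,dV(z)$. For entire functions $\psi,\varphi$, the maximal weighted composition operator $W_{\psi,\varphi,\max}$ on $\mathcal F^2$ has domain $\{f\in\mathcal F^2:\psi\cdot (f\circ\varphi)\in\mathcal F^2\}$ and maps $f$ to $\psi\cdot (f\circ\varphi)$. An unbounded (that is, not necessarily bounded) weighted composition operator $W_{\psi,\varphi}$ is a restriction of $W_{\psi,\varphi,\max}$ to some linear subspace of this domain. An operator $T$ on $\mathcal F^2$ is Hermitian if it is closed, densely defined and $T=T^*$ (with equality of domains). **Theorem 5.3.** Let $\psi,\varphi$ be entire functions with $\psi\not\equiv 0$, and let $W_{\psi,\varphi}$ be an unbounded weighted composition operator on $\mathcal F^2$ induced by $\psi,\varphi$. Then $W_{\psi,\varphi}$ is Hermitian if and only if the following two conditions hold. 1. $W_{\psi,\varphi}=W_{\psi,\varphi,\max}$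 (with equality of domains). 2. There are $A\in\mathbb R$, $C\in\mathbb R\setminus\{0\}$ and $B\in\mathbb C$ such that $\varphi(z)=Az+B$ and $\psi(z)=Ce^{\overline{B}z}$ for all $z\in\mathbb C$. -/

import Mathlib

open MeasureTheory Filter Topology
open scoped ComplexConjugate ENNReal

noncomputable section

/-- The Gaussian measure `π⁻¹ e^{-|z|²} dV(z)` on `ℂ`, with `dV` Lebesgue measure. -/
def fockMeasure : Measure ℂ :=
  volume.withDensity fun z => ENNReal.ofReal (Real.pi⁻¹ * Real.exp (-‖z‖ ^ 2))

/-- The entire functions that are square integrable for the Gaussian measure, as a subspace of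
the space of all functions `ℂ → ℂ`. -/
def fockSubmodule : Submodule ℂ (ℂ → ℂ) where
  carrier := {f | Differentiable ℂ f ∧ MemLp f 2 fockMeasure}
  zero_mem' := ⟨differentiable_const 0, MemLp.zero⟩
  add_mem' hf hg := ⟨hf.1.add hg.1, hf.2.add hg.2⟩
  smul_mem' c _ hf := ⟨hf.1.const_smul c, hf.2.const_smul c⟩

/-- The Fock space `𝓕²`. This is a type of its own, so that its topology is the one
of its inner product and not the topology of pointwise convergence. -/
def FockSpace : Type := fockSubmodule

namespace FockSpace

instance : AddCommGroup FockSpace := inferInstanceAs (AddCommGroup fockSubmodule)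

instance : Module ℂ FockSpace := inferInstanceAs (Module ℂ fockSubmodule)

instance : CoeFun FockSpace fun _ => ℂ → ℂ := ⟨fun f => f.1⟩

/-- The element of the Fock space given by an entire function that is square integrable. -/
def mk (f : ℂ → ℂ) (hf : f ∈ fockSubmodule) : FockSpace := ⟨f, hf⟩

@[simp] theorem mk_apply (f : ℂ → ℂ) (hf : f ∈ fockSubmodule) (z : ℂ) : mk f hf z = f z := rfl

@[ext] theorem ext {f g : FockSpace} (h : ∀ z, f z = g z) : f = g := Subtype.ext (funext h)

@[simp] theorem zero_apply (z : ℂ) : (0 : FockSpace) z = 0 := rfl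
@[simp] theorem add_apply (f g : FockSpace) (z : ℂ) : (f + g) z = f z + g z := rfl
@[simp] theorem sub_apply (f g : FockSpace) (z : ℂ) : (f - g) z = f z - g z := rfl
@[simp] theorem smul_apply (c : ℂ) (f : FockSpace) (z : ℂ) : (c • f) z = c * f z := rfl

theorem differentiable (f : FockSpace) : Differentiable ℂ f := f.2.1

theorem memLp (f : FockSpace) : MemLp f 2 fockMeasure := f.2.2

theorem volume_absolutelyContinuous : (volume : Measure ℂ) ≪ fockMeasure := by
  refine withDensity_absolutelyContinuous' (by fun_prop) (ae_of_all _ fun z => ?_)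
  exact (ENNReal.ofReal_pos.2 (by positivity)).ne'

theorem eq_of_ae_eq {f g : FockSpace} (h : f =ᵐ[fockMeasure] g) : f = g := by
  have h1 : f =ᵐ[(volume : Measure ℂ)] g := volume_absolutelyContinuous.ae_le h
  exact ext (congrFun (Continuous.ae_eq_iff_eq volume f.differentiable.continuous
    g.differentiable.continuous |>.1 h1))

theorem integrable_conj_mul (f g : FockSpace) :
    Integrable (fun z => conj (f z) * g z) fockMeasure :=
  (f.memLp.star).integrable_mul g.memLp

/-- The inner product. Mathlib's convention is conjugate-linear in the first variable, so that
`inner ℂ g f = π⁻¹ ∫ f(z) conj(g(z)) e^{-|z|²} dV(z)`. -/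
@[reducible] def core : InnerProductSpace.Core ℂ FockSpace where
  inner f g := ∫ z, conj (f z) * g z ∂fockMeasure
  conj_inner_symm f g := by
    rw [← integral_conj]
    congr 1
    ext z
    simp [mul_comm]
  re_inner_nonneg f := by
    have h : ∀ z, conj (f z) * f z = ((‖f z‖ ^ 2 : ℝ) : ℂ) := fun z => by
      rw [mul_comm, Complex.mul_conj']; push_cast; rfl
    simp only [h]
    rw [integral_complex_ofReal]
    simpa using integral_nonneg fun z => by positivity
  add_left f g h := by
    rw [← integral_add (integrable_conj_mul f h) (integrable_conj_mul g h)]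
    congr 1
    ext z
    simp [add_mul]
  smul_left f g c := by
    rw [← integral_const_mul]
    congr 1
    ext z
    simp [mul_assoc]
  definite f hf := by
    have h : ∀ z, conj (f z) * f z = ((‖f z‖ ^ 2 : ℝ) : ℂ) := fun z => by
      rw [mul_comm, Complex.mul_conj']; push_cast; rfl
    simp only [h] at hf
    rw [integral_complex_ofReal, Complex.ofReal_eq_zero,
      integral_eq_zero_iff_of_nonneg (fun z => by positivity) f.memLp.norm.integrable_sq] at hf
    refine eq_of_ae_eq ?_
    filter_upwards [hf] with z hz
    simpa using hz

instance : NormedAddCommGroup FockSpace := core.toNormedAddCommGroup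

instance : InnerProductSpace ℂ FockSpace := InnerProductSpace.ofCore core.toCore

theorem inner_def (f g : FockSpace) : inner ℂ f g = ∫ z, conj (f z) * g z ∂fockMeasure := rfl

/-- The inner product in terms of Lebesgue measure. -/
theorem inner_eq (f g : FockSpace) :
    inner ℂ g f = (Real.pi : ℂ)⁻¹ * ∫ z, f z * conj (g z) * (Real.exp (-‖z‖ ^ 2) : ℂ) := by
  rw [inner_def, fockMeasure, integral_withDensity_eq_integral_toReal_smul (by fun_prop)
    (ae_of_all _ fun z => ENNReal.ofReal_lt_top), ← integral_const_mul]
  congr 1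
  ext z
  rw [ENNReal.toReal_ofReal (by positivity), Complex.real_smul]
  push_cast
  ring

/-- The isometric embedding into `L²` of the Gaussian measure. -/
def toL2 : FockSpace →ₗᵢ[ℂ] Lp ℂ 2 fockMeasure where
  toFun f := f.memLp.toLp f
  map_add' _ _ := rfl
  map_smul' _ _ := rfl
  norm_map' f := by
    have h : inner ℂ (f.memLp.toLp f) (f.memLp.toLp f) = inner ℂ f f := by
      rw [L2.inner_def, inner_def]
      refine integral_congr_ae ?_
      filter_upwards [f.memLp.coeFn_toLp] with z hz
      rw [hz, RCLike.inner_apply, mul_comm]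
    change ‖f.memLp.toLp f‖ = ‖f‖
    rw [@norm_eq_sqrt_re_inner ℂ, @norm_eq_sqrt_re_inner ℂ, h]

theorem coeFn_toL2 (f : FockSpace) : toL2 f =ᵐ[fockMeasure] f := f.memLp.coeFn_toLp

/-- The mean value property on a disc of radius one. -/
theorem integral_ball_eq {f : ℂ → ℂ} (hf : Differentiable ℂ f) (c : ℂ) :
    ∫ w in Metric.ball (0 : ℂ) 1, f (c + w) = Real.pi * f c := by
  have hpi := Real.pi_pos
  rw [← integral_indicator Metric.isOpen_ball.measurableSet,
    ← Complex.integral_comp_polarCoord_symm]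
  have h1 : ∫ p in polarCoord.target, p.1 • (Metric.ball (0 : ℂ) 1).indicator
        (fun w => f (c + w)) (Complex.polarCoord.symm p) =
      ∫ p in polarCoord.target, (Set.Ioo (0 : ℝ) 1 ×ˢ Set.Ioo (-Real.pi) Real.pi).indicator
        (fun p => p.1 • f (c + Complex.polarCoord.symm p)) p := by
    refine setIntegral_congr_fun polarCoord.open_target.measurableSet fun p hp => ?_
    have hp1 : 0 < p.1 := hp.1
    have hp2 : p.2 ∈ Set.Ioo (-Real.pi) Real.pi := hp.2
    have hiff : Complex.polarCoord.symm p ∈ Metric.ball (0 : ℂ) 1 ↔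
        p ∈ Set.Ioo (0 : ℝ) 1 ×ˢ Set.Ioo (-Real.pi) Real.pi := by
      rw [mem_ball_zero_iff, Complex.norm_polarCoord_symm, abs_of_pos hp1]
      exact ⟨fun h => ⟨⟨hp1, h⟩, hp2⟩, fun h => h.1.2⟩
    by_cases hm : Complex.polarCoord.symm p ∈ Metric.ball (0 : ℂ) 1
    · simp only [Set.indicator_of_mem hm, Set.indicator_of_mem (hiff.1 hm)]
    · simp only [Set.indicator_of_notMem hm, Set.indicator_of_notMem (mt hiff.2 hm), smul_zero]
  have hms : MeasurableSet (Set.Ioo (0 : ℝ) 1 ×ˢ Set.Ioo (-Real.pi) Real.pi) :=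
    measurableSet_Ioo.prod measurableSet_Ioo
  have hsub : Set.Ioo (0 : ℝ) 1 ×ˢ Set.Ioo (-Real.pi) Real.pi ⊆ polarCoord.target :=
    Set.prod_mono (fun x hx => hx.1) le_rfl
  rw [h1, setIntegral_indicator hms, Set.inter_eq_self_of_subset_right hsub]
  have hcont : Continuous fun p : ℝ × ℝ => p.1 • f (c + Complex.polarCoord.symm p) := by
    have := hf.continuous
    simp only [Complex.polarCoord_symm_apply]
    fun_prop
  have hint : IntegrableOn (fun p : ℝ × ℝ => p.1 • f (c + Complex.polarCoord.symm p))
      (Set.Ioo (0 : ℝ) 1 ×ˢ Set.Ioo (-Real.pi) Real.pi) (volume.prod volume) :=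
    (hcont.continuousOn.integrableOn_compact (isCompact_Icc.prod isCompact_Icc)).mono_set
      (Set.prod_mono Set.Ioo_subset_Icc_self Set.Ioo_subset_Icc_self)
  rw [Measure.volume_eq_prod, setIntegral_prod _ hint]
  have h2 : ∀ r : ℝ, ∫ θ in Set.Ioo (-Real.pi) Real.pi,
      r • f (c + Complex.polarCoord.symm (r, θ)) = (r * (2 * Real.pi)) • f c := by
    intro r
    have hmv : Real.circleAverage f c r = f c :=
      DiffContOnCl.circleAverage hf.diffContOnCl
    rw [Real.circleAverage_def] at hmv
    have hper : (fun θ => f (circleMap c r θ)).Periodic (2 * Real.pi) :=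
      fun x => by simp [periodic_circleMap c r x]
    have h3 := hper.intervalIntegral_add_eq 0 (-Real.pi)
    rw [zero_add, show -Real.pi + 2 * Real.pi = Real.pi by ring] at h3
    rw [integral_smul, ← integral_Ioc_eq_integral_Ioo,
      ← intervalIntegral.integral_of_le (by linarith), mul_smul]
    congr 1
    have h4 : ∀ θ : ℝ, f (c + Complex.polarCoord.symm (r, θ)) = f (circleMap c r θ) := by
      intro θ
      rw [Complex.polarCoord_symm_apply, circleMap, Complex.exp_mul_I]
      push_cast
      rfl
    simp only [h4]
    rw [← h3, ← hmv, smul_smul, mul_inv_cancel₀ (by positivity), one_smul]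
  simp only [h2]
  rw [integral_smul_const, integral_mul_const, ← integral_Ioc_eq_integral_Ioo,
    ← intervalIntegral.integral_of_le zero_le_one, integral_id, Complex.real_smul]
  push_cast
  ring

theorem integrable_norm_sq (f : FockSpace) :
    Integrable fun z => ‖f z‖ ^ 2 * Real.exp (-‖z‖ ^ 2) := by
  have h := f.memLp.norm.integrable_sq
  rw [fockMeasure, integrable_withDensity_iff_integrable_smul' (by fun_prop)
    (ae_of_all _ fun z => ENNReal.ofReal_lt_top)] at h
  refine (h.const_mul Real.pi).congr (ae_of_all _ fun z => ?_)
  have := Real.pi_pos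
  simp only [smul_eq_mul]
  rw [ENNReal.toReal_ofReal (by positivity)]
  field_simp

theorem norm_sq_eq (f : FockSpace) :
    ‖f‖ ^ 2 = Real.pi⁻¹ * ∫ z, ‖f z‖ ^ 2 * Real.exp (-‖z‖ ^ 2) := by
  have h := inner_eq f f
  have h1 : ∀ z, f z * conj (f z) * (Real.exp (-‖z‖ ^ 2) : ℂ) =
      ((‖f z‖ ^ 2 * Real.exp (-‖z‖ ^ 2) : ℝ) : ℂ) := fun z => by
    rw [Complex.mul_conj']; push_cast; rfl
  simp only [h1] at h
  rw [inner_self_eq_norm_sq_to_K, integral_complex_ofReal] at h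
  have h2 : ((‖f‖ ^ 2 : ℝ) : ℂ) =
      ((Real.pi⁻¹ * ∫ z, ‖f z‖ ^ 2 * Real.exp (-‖z‖ ^ 2) : ℝ) : ℂ) := by
    push_cast
    exact h
  exact Complex.ofReal_injective h2

/-- Point evaluations are bounded, locally uniformly in the point. -/
theorem norm_apply_sq_le (f : FockSpace) {z : ℂ} {R : ℝ} (hz : ‖z‖ ≤ R) :
    ‖f z‖ ^ 2 ≤ Real.exp ((R + 1) ^ 2) * ‖f‖ ^ 2 := by
  have hpi := Real.pi_pos
  have hmv := integral_ball_eq (f.differentiable.pow 2) z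
  have hint : Integrable fun w => ‖f (z + w)‖ ^ 2 * Real.exp (-‖z + w‖ ^ 2) :=
    (integrable_norm_sq f).comp_add_left z
  have hcont : Continuous fun w => f (z + w) := by
    have := f.differentiable.continuous
    fun_prop
  have h1 : Real.pi * ‖f z‖ ^ 2 ≤ ∫ w in Metric.ball (0 : ℂ) 1, ‖f (z + w)‖ ^ 2 := by
    have := norm_integral_le_integral_norm (μ := volume.restrict (Metric.ball (0 : ℂ) 1))
      fun w => (f ^ 2 : ℂ → ℂ) (z + w)
    rw [hmv] at this
    simpa [abs_of_pos hpi] using this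
  have h2 : ∫ w in Metric.ball (0 : ℂ) 1, ‖f (z + w)‖ ^ 2 ≤
      ∫ w in Metric.ball (0 : ℂ) 1,
        Real.exp ((R + 1) ^ 2) * (‖f (z + w)‖ ^ 2 * Real.exp (-‖z + w‖ ^ 2)) := by
    refine setIntegral_mono_on ?_ (hint.const_mul _).integrableOn
      Metric.isOpen_ball.measurableSet fun w hw => ?_
    · exact ((hcont.norm.pow 2).continuousOn.integrableOn_compact
        (isCompact_closedBall (0 : ℂ) 1)).mono_set Metric.ball_subset_closedBall
    · rw [mul_left_comm, ← Real.exp_add]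
      refine le_mul_of_one_le_right (by positivity) (Real.one_le_exp ?_)
      have hw' : ‖w‖ < 1 := by simpa using hw
      have h3 : ‖z + w‖ ≤ R + 1 := (norm_add_le z w).trans (by linarith)
      nlinarith [norm_nonneg (z + w)]
  have h4 : ∫ w in Metric.ball (0 : ℂ) 1,
        Real.exp ((R + 1) ^ 2) * (‖f (z + w)‖ ^ 2 * Real.exp (-‖z + w‖ ^ 2)) ≤
      ∫ w, Real.exp ((R + 1) ^ 2) * (‖f (z + w)‖ ^ 2 * Real.exp (-‖z + w‖ ^ 2)) :=
    setIntegral_le_integral (hint.const_mul _) (ae_of_all _ fun w => by positivity)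
  have h5 := h4.trans_eq (integral_const_mul _ _)
  rw [integral_add_left_eq_self (fun w => ‖f w‖ ^ 2 * Real.exp (-‖w‖ ^ 2)) z] at h5
  rw [norm_sq_eq f, ← mul_le_mul_iff_right₀ hpi]
  refine (h1.trans (h2.trans h5)).trans_eq ?_
  field_simp

theorem norm_apply_le (f : FockSpace) {z : ℂ} {R : ℝ} (hz : ‖z‖ ≤ R) :
    ‖f z‖ ≤ Real.exp ((R + 1) ^ 2) * ‖f‖ := by
  have h := norm_apply_sq_le f hz
  have h1 : 1 ≤ Real.exp ((R + 1) ^ 2) := Real.one_le_exp (by positivity)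
  refine (sq_le_sq₀ (by positivity) (by positivity)).1 ?_
  refine h.trans ?_
  rw [mul_pow]
  refine mul_le_mul_of_nonneg_right ?_ (by positivity)
  nlinarith

instance : CompleteSpace FockSpace := by
  refine Metric.complete_of_cauchySeq_tendsto fun u hu => ?_
  have hunif : ∀ R : ℝ, UniformCauchySeqOn (fun n z => u n z) atTop {z | ‖z‖ ≤ R} := by
    intro R
    rw [Metric.uniformCauchySeqOn_iff]
    intro ε hε
    have hE := Real.exp_pos ((R + 1) ^ 2)
    obtain ⟨N, hN⟩ := Metric.cauchySeq_iff.1 hu (ε / Real.exp ((R + 1) ^ 2)) (by positivity)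
    refine ⟨N, fun m hm n hn z hz => ?_⟩
    have h1 := norm_apply_le (u m - u n) hz
    have h2 := hN m hm n hn
    rw [dist_eq_norm, lt_div_iff₀ hE] at h2
    rw [dist_eq_norm, ← sub_apply]
    linarith
  have hpt : ∀ z, ∃ y, Tendsto (fun n => u n z) atTop (𝓝 y) := fun z =>
    cauchySeq_tendsto_of_complete ((hunif ‖z‖).cauchySeq (x := z) (le_refl ‖z‖))
  choose f hf using hpt
  have hloc : TendstoLocallyUniformlyOn (fun n z => u n z) f atTop Set.univ := by
    rw [tendstoLocallyUniformlyOn_iff_forall_isCompact isOpen_univ]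
    intro K _ hK
    obtain ⟨R, hR⟩ := hK.isBounded.exists_norm_le
    exact ((hunif R).mono fun z hz => hR z hz).tendstoUniformlyOn_of_tendsto fun z _ => hf z
  have hdiff : Differentiable ℂ f := by
    rw [← differentiableOn_univ]
    exact hloc.differentiableOn
      (Eventually.of_forall fun n => (u n).differentiable.differentiableOn) isOpen_univ
  have hcau : CauchySeq fun n => toL2 (u n) := toL2.isometry.uniformContinuous.comp_cauchySeq hu
  obtain ⟨g, hg⟩ := cauchySeq_tendsto_of_complete hcau
  obtain ⟨ns, hns, hae⟩ := (tendstoInMeasure_of_tendsto_Lp hg).exists_seq_tendsto_ae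
  have hfg : f =ᵐ[fockMeasure] g := by
    have hall : ∀ᵐ z ∂fockMeasure, ∀ n, toL2 (u n) z = u n z :=
      ae_all_iff.2 fun n => coeFn_toL2 (u n)
    filter_upwards [hae, hall] with z h1 h2
    refine tendsto_nhds_unique ((hf z).comp hns.tendsto_atTop) ?_
    simpa only [Function.comp_def, h2] using h1
  have hmem : MemLp f 2 fockMeasure := (memLp_congr_ae hfg).2 (Lp.memLp g)
  let F : FockSpace := mk f ⟨hdiff, hmem⟩
  have hF : toL2 F = g := Lp.ext ((coeFn_toL2 F).trans hfg)
  refine ⟨F, toL2.isometry.isUniformInducing.isInducing.tendsto_nhds_iff.2 ?_⟩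
  rw [hF]
  exact hg

end FockSpace

/-- The maximal weighted composition operator on the Fock space: its domain is
`{f ∈ 𝓕² | ψ · f ∘ φ ∈ 𝓕²}`, and it maps `f` to `ψ · f ∘ φ`. -/
def maximalWeightedComp (ψ φ : ℂ → ℂ) : FockSpace →ₗ.[ℂ] FockSpace where
  domain :=
    { carrier := {f | (fun z => ψ z * f (φ z)) ∈ fockSubmodule}
      zero_mem' := by
        simpa [Pi.zero_def] using! fockSubmodule.zero_mem
      add_mem' := fun {f g} hf hg => by
        simpa [mul_add, Pi.add_def] using fockSubmodule.add_mem hf hg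
      smul_mem' := fun c f hf => by
        simpa [Pi.smul_def, mul_left_comm] using fockSubmodule.smul_mem c hf }
  toFun :=
    { toFun := fun f => FockSpace.mk (fun z => ψ z * (f : FockSpace) (φ z)) f.2
      map_add' := fun f g => by ext z; simp [mul_add]
      map_smul' := fun c f => by ext z; simp [mul_left_comm] }

/-- An unbounded weighted composition operator with symbols `ψ`, `φ`: a linear operator, defined on
some subspace of the Fock space, of which the maximal weighted composition operator is an
extension. -/
def IsWeightedComp (ψ φ : ℂ → ℂ) (W : FockSpace →ₗ.[ℂ] FockSpace) : Prop :=
  W ≤ maximalWeightedComp ψ φ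

/-- A closed densely defined operator is Hermitian if it equals its adjoint. -/
def IsHermitianOp (T : FockSpace →ₗ.[ℂ] FockSpace) : Prop :=
  T.IsClosed ∧ Dense (T.domain : Set FockSpace) ∧ T.adjoint = T

end

/-! ### Gaussian integrals and the reproducing kernel. -/

namespace FockSpace

/-! Write K_w for the reproducing kernel at w. Pairing with K_w is evaluation at w, so the adjoint
of any densely defined weighted composition operator sends K_w to conj(ψ(w)) K_{φ(w)}. If the
operator is Hermitian, the operator itself must do the same, which is the functional equation
`KernelSymmetric`. Its cases w = 0 and w = 1 already force the stated form of ψ and φ.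

Conversely, these symbols satisfy the functional equation. The maximal operator T then maps the span
D of the kernels into itself, is symmetric on D, and is exactly the adjoint of its restriction to D.
By von Neumann's criterion (`LinearPMap.adjoint_eq_self_of_core`), T is self-adjoint once neither i
nor -i is an eigenvalue. For A ≠ 1, recentring at the fixed point of φ turns T into a real multiple
of a real dilation, which acts on Taylor coefficients by real factors. For A = 1, an eigenfunction
times a suitable Gaussian is bounded and entire, and Liouville's theorem applies.

Finally, a Hermitian W contained in the self-adjoint T equals T, because passing to adjoints
reverses the inclusion. -/

theorem integrable_gaussian : Integrable fun z : ℂ => Real.exp (-‖z‖ ^ 2) := by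
  have h := GaussianFourier.integrable_cexp_neg_mul_sq_norm_add (V := ℂ) (b := 1)
    (by norm_num) 0 0
  refine h.norm.congr (ae_of_all _ fun z => ?_)
  simp [Complex.norm_exp, ← Complex.ofReal_pow]

theorem integral_gaussian : ∫ z : ℂ, Real.exp (-‖z‖ ^ 2) = Real.pi := by
  have h := GaussianFourier.integral_rexp_neg_mul_sq_norm (V := ℂ) one_pos
  simpa [Complex.finrank_real_complex] using h

/-- The mean value property for the Gaussian measure. -/
theorem integral_mul_gaussian {g : ℂ → ℂ} (hg : Differentiable ℂ g)
    (hint : Integrable fun u => g u * (Real.exp (-‖u‖ ^ 2) : ℂ)) :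
    ∫ u, g u * (Real.exp (-‖u‖ ^ 2) : ℂ) = Real.pi * g 0 := by
  have hpi := Real.pi_pos
  -- The weight is rotation invariant, so g may be replaced by its average over circles about 0,
  -- which is g 0; Fubini justifies the exchange.
  have hrot : ∀ θ : ℝ, MeasurePreserving (fun u : ℂ => circleMap 0 1 θ * u) volume volume := by
    intro θ
    have h := (rotation (Circle.exp θ)).measurePreserving
    have he : (rotation (Circle.exp θ) : ℂ → ℂ) = fun u => circleMap 0 1 θ * u :=
      funext fun u => by simp [circleMap]
    rwa [he] at h
  have hemb : ∀ θ : ℝ, MeasurableEmbedding (fun u : ℂ => circleMap 0 1 θ * u) := fun θ =>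
    (Homeomorph.mulLeft₀ (circleMap 0 1 θ)
      (circleMap_ne_center one_ne_zero)).measurableEmbedding
  have hnorm : ∀ (θ : ℝ) (u : ℂ), ‖circleMap 0 1 θ * u‖ = ‖u‖ := fun θ u => by
    simp
  have hintθ : ∀ θ : ℝ, Integrable fun u =>
      g (circleMap 0 1 θ * u) * (Real.exp (-‖u‖ ^ 2) : ℂ) := fun θ => by
    simpa only [Function.comp_def, hnorm] using ((hrot θ).integrable_comp_emb (hemb θ)).2 hint
  have hc : Continuous fun p : ℝ × ℂ =>
      g (circleMap 0 1 p.1 * p.2) * (Real.exp (-‖p.2‖ ^ 2) : ℂ) := by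
    have := hg.continuous
    have := continuous_circleMap 0 1
    fun_prop
  have hprod : Integrable (fun p : ℝ × ℂ =>
      g (circleMap 0 1 p.1 * p.2) * (Real.exp (-‖p.2‖ ^ 2) : ℂ))
      ((volume.restrict (Set.uIoc 0 (2 * Real.pi))).prod volume) := by
    rw [integrable_prod_iff hc.aestronglyMeasurable]
    refine ⟨ae_of_all _ hintθ, ?_⟩
    have hconst : ∀ θ : ℝ, ∫ u, ‖g (circleMap 0 1 θ * u) * (Real.exp (-‖u‖ ^ 2) : ℂ)‖ =
        ∫ u, ‖g u * (Real.exp (-‖u‖ ^ 2) : ℂ)‖ := fun θ => by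
      have h := (hrot θ).integral_comp (hemb θ) fun u => ‖g u * (Real.exp (-‖u‖ ^ 2) : ℂ)‖
      simpa only [hnorm] using h
    simp only [hconst]
    exact integrableOn_const (by simp [Set.uIoc])
  have h1 : ∫ θ in (0)..(2 * Real.pi),
      ∫ u, g (circleMap 0 1 θ * u) * (Real.exp (-‖u‖ ^ 2) : ℂ) =
      ∫ u, ∫ θ in (0)..(2 * Real.pi),
        g (circleMap 0 1 θ * u) * (Real.exp (-‖u‖ ^ 2) : ℂ) :=
    intervalIntegral_integral_swap hprod
  have h2 : ∀ θ : ℝ, ∫ u, g (circleMap 0 1 θ * u) * (Real.exp (-‖u‖ ^ 2) : ℂ) =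
      ∫ u, g u * (Real.exp (-‖u‖ ^ 2) : ℂ) := fun θ => by
    have h := (hrot θ).integral_comp (hemb θ) fun u => g u * (Real.exp (-‖u‖ ^ 2) : ℂ)
    simpa only [hnorm] using h
  have h3 : ∀ u : ℂ, ∫ θ in (0)..(2 * Real.pi), g (circleMap 0 1 θ * u) =
      (2 * Real.pi : ℝ) * g 0 := by
    intro u
    have hd : Differentiable ℂ fun w => g (w * u) := hg.comp (differentiable_id.mul_const u)
    have hmv : Real.circleAverage (fun w => g (w * u)) 0 1 = g (0 * u) :=
      DiffContOnCl.circleAverage hd.diffContOnCl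
    rw [Real.circleAverage_def, zero_mul] at hmv
    rw [← hmv, ← Complex.real_smul, smul_smul, mul_inv_cancel₀ (by positivity), one_smul]
  simp only [h2, intervalIntegral.integral_mul_const, h3] at h1
  rw [intervalIntegral.integral_const, integral_const_mul, integral_complex_ofReal,
    integral_gaussian, sub_zero, Complex.real_smul] at h1
  have h4 : ((2 * Real.pi : ℝ) : ℂ) ≠ 0 := by
    exact_mod_cast (by positivity : (2 * Real.pi : ℝ) ≠ 0)
  refine mul_left_cancel₀ h4 (h1.trans ?_)
  ring

theorem norm_sq_add (w u : ℂ) : ‖w + u‖ ^ 2 = ‖w‖ ^ 2 + 2 * (conj w * u).re + ‖u‖ ^ 2 := by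
  rw [← Complex.normSq_eq_norm_sq, ← Complex.normSq_eq_norm_sq, ← Complex.normSq_eq_norm_sq,
    Complex.normSq_add]
  simp [Complex.mul_re]
  ring

theorem norm_cexp_sq (s : ℂ) : ‖Complex.exp s‖ ^ 2 = Real.exp (2 * s.re) := by
  rw [Complex.norm_exp, ← Real.exp_nat_mul]
  norm_num

theorem mem_fockSubmodule_of_integrable {f : ℂ → ℂ} (hf : Differentiable ℂ f)
    (hint : Integrable fun z => ‖f z‖ ^ 2 * Real.exp (-‖z‖ ^ 2)) : f ∈ fockSubmodule := by
  refine ⟨hf, (memLp_two_iff_integrable_sq_norm hf.continuous.aestronglyMeasurable).2 ?_⟩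
  rw [fockMeasure, integrable_withDensity_iff_integrable_smul' (by fun_prop)
    (ae_of_all _ fun z => ENNReal.ofReal_lt_top)]
  refine (hint.const_mul Real.pi⁻¹).congr (ae_of_all _ fun z => ?_)
  have := Real.pi_pos
  simp only [smul_eq_mul]
  rw [ENNReal.toReal_ofReal (by positivity)]
  ring

theorem cexp_mem_fockSubmodule (w : ℂ) :
    (fun z => Complex.exp (conj w * z)) ∈ fockSubmodule := by
  refine mem_fockSubmodule_of_integrable (by fun_prop) ?_
  -- Completing the square turns the weighted square modulus into exp(|w|²) times a Gaussian centred
  -- at w.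
  have h := (integrable_gaussian.comp_sub_right w).const_mul (Real.exp (‖w‖ ^ 2))
  refine h.congr (ae_of_all _ fun z => ?_)
  have h1 := norm_sq_add w (z - w)
  rw [add_sub_cancel] at h1
  have h2 : (conj w * (z - w)).re = (conj w * z).re - ‖w‖ ^ 2 := by
    rw [mul_sub, Complex.conj_mul', ← Complex.ofReal_pow, Complex.sub_re, Complex.ofReal_re]
  simp only
  rw [norm_cexp_sq, ← Real.exp_add, ← Real.exp_add]
  congr 1
  rw [h1, h2]
  ring

/-- The reproducing kernel `z ↦ exp (conj w * z)` of the Fock space. -/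
noncomputable def kernel (w : ℂ) : FockSpace := mk _ (cexp_mem_fockSubmodule w)

@[simp] theorem kernel_apply (w z : ℂ) : kernel w z = Complex.exp (conj w * z) := rfl

@[simp] theorem inner_kernel (w : ℂ) (f : FockSpace) : inner ℂ (kernel w) f = f w := by
  have hpi : (Real.pi : ℂ) ≠ 0 := by exact_mod_cast Real.pi_ne_zero
  -- After the shift by w, the antiholomorphic factors of the conjugated kernel and of the weight
  -- cancel. What is left is the centred Gaussian times this entire function, to which the mean
  -- value property applies.
  set g : ℂ → ℂ := fun u => f (w + u) * Complex.exp (-(conj w * u)) with hg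
  have hgd : Differentiable ℂ g := by
    have := f.differentiable
    fun_prop
  have hshift : ∀ u, f (w + u) * conj (kernel w (w + u)) * (Real.exp (-‖w + u‖ ^ 2) : ℂ) =
      g u * (Real.exp (-‖u‖ ^ 2) : ℂ) := by
    intro u
    simp only [hg, kernel_apply, mul_assoc, Complex.ofReal_exp, ← Complex.exp_conj,
      ← Complex.exp_add]
    congr 2
    push_cast
    rw [← Complex.conj_mul', ← Complex.conj_mul']
    simp
    ring
  have hint : Integrable fun z => f z * conj (kernel w z) * (Real.exp (-‖z‖ ^ 2) : ℂ) := by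
    have h := integrable_conj_mul (kernel w) f
    rw [fockMeasure, integrable_withDensity_iff_integrable_smul' (by fun_prop)
      (ae_of_all _ fun z => ENNReal.ofReal_lt_top)] at h
    refine (h.const_mul (Real.pi : ℂ)).congr (ae_of_all _ fun z => ?_)
    have := Real.pi_pos
    simp only
    rw [ENNReal.toReal_ofReal (by positivity), Complex.real_smul]
    push_cast
    field_simp
  have hint' := hint.comp_add_left w
  simp only [hshift] at hint'
  rw [inner_eq, ← integral_add_left_eq_self _ w]
  simp only [hshift]
  rw [integral_mul_gaussian hgd hint']
  simp [hg, hpi]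

theorem norm_kernel (w : ℂ) : ‖kernel w‖ = Real.exp (‖w‖ ^ 2 / 2) := by
  have h := inner_kernel w (kernel w)
  rw [inner_self_eq_norm_sq_to_K, kernel_apply, Complex.conj_mul'] at h
  have h1 : ‖kernel w‖ ^ 2 = Real.exp (‖w‖ ^ 2) := by
    apply Complex.ofReal_injective
    push_cast
    exact h
  rw [← sq_eq_sq₀ (norm_nonneg _) (Real.exp_pos _).le, h1, ← Real.exp_nat_mul]
  congr 1
  push_cast
  ring

/-- Cauchy–Schwarz against the kernel gives the sharp growth exponent 1/2, which the Liouville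
argument for translations needs. -/
theorem norm_apply_le_exp (f : FockSpace) (w : ℂ) :
    ‖f w‖ ≤ Real.exp (‖w‖ ^ 2 / 2) * ‖f‖ := by
  rw [← inner_kernel, ← norm_kernel]
  exact norm_inner_le_norm _ _

/-- The span of the reproducing kernels. -/
def kernelSpan : Submodule ℂ FockSpace := Submodule.span ℂ (Set.range kernel)

theorem kernel_mem_kernelSpan (w : ℂ) : kernel w ∈ kernelSpan :=
  Submodule.subset_span ⟨w, rfl⟩

theorem dense_kernelSpan : Dense (kernelSpan : Set FockSpace) := by
  rw [Submodule.dense_iff_topologicalClosure_eq_top,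
    Submodule.topologicalClosure_eq_top_iff, Submodule.eq_bot_iff]
  intro f hf
  ext w
  rw [← inner_kernel]
  exact hf _ (kernel_mem_kernelSpan w)

end FockSpace

/-! ### A criterion for self-adjointness. -/

section Hilbert

variable {E : Type*} [NormedAddCommGroup E] [InnerProductSpace ℂ E]

/-- The inner product of T u and u is real, so the cross term vanishes and ‖T u + i u‖² = ‖T u‖² +
‖u‖². -/
theorem LinearPMap.norm_le_norm_add_I_smul {T : E →ₗ.[ℂ] E} {u : T.domain}
    (h : inner ℂ (T u) (u : E) = inner ℂ (u : E) (T u)) :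
    ‖(u : E)‖ ≤ ‖T u + Complex.I • (u : E)‖ := by
  have hre : (inner ℂ (T u) (Complex.I • (u : E))).re = 0 := by
    have him : (inner ℂ (T u) (u : E)).im = 0 := by
      rw [← Complex.conj_eq_iff_im, inner_conj_symm, h]
    rw [inner_smul_right, Complex.mul_re, him]
    simp
  have h1 := norm_add_sq (𝕜 := ℂ) (T u) (Complex.I • (u : E))
  rw [RCLike.re_eq_complex_re, hre, norm_smul, Complex.norm_I, one_mul] at h1
  refine (sq_le_sq₀ (norm_nonneg _) (norm_nonneg _)).1 ?_
  nlinarith [sq_nonneg ‖T u‖]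

/-- An operator that is the adjoint of its restriction to a dense subspace, and for which `I` and
`-I` are not eigenvalues, equals its adjoint. -/
theorem LinearPMap.adjoint_eq_self_of_core [CompleteSpace E] {T : E →ₗ.[ℂ] E} {D : Submodule ℂ E}
    (hD : D ≤ T.domain) (hdense : Dense (D : Set E))
    (hsymm : ∀ f u : T.domain, (u : E) ∈ D → inner ℂ (T f) (u : E) = inner ℂ (f : E) (T u))
    (hmax : ∀ f g : E, (∀ u : T.domain, (u : E) ∈ D → inner ℂ g (u : E) = inner ℂ f (T u)) →
      ∃ hf : f ∈ T.domain, T ⟨f, hf⟩ = g)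
    (hI : ∀ f : T.domain, T f = Complex.I • (f : E) → (f : E) = 0)
    (hnegI : ∀ f : T.domain, T f = -Complex.I • (f : E) → (f : E) = 0) :
    T.adjoint = T := by
  have hTdense : Dense (T.domain : Set E) := hdense.mono hD
  have hclosed : ∀ (u : ℕ → T.domain) (f g : E), Tendsto (fun n => (u n : E)) atTop (𝓝 f) →
      Tendsto (fun n => T (u n)) atTop (𝓝 g) → ∃ hf : f ∈ T.domain, T ⟨f, hf⟩ = g := by
    intro u f g hf hg
    refine hmax f g fun v hv => ?_
    refine tendsto_nhds_unique (hg.inner tendsto_const_nhds) ?_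
    simpa only [hsymm _ v hv] using hf.inner (tendsto_const_nhds (x := T v))
  let S : T.domain →ₗ[ℂ] E := T.toFun + Complex.I • T.domain.subtype
  have hS : ∀ u, S u = T u + Complex.I • (u : E) := fun u => rfl
  let R : Submodule ℂ E := (D.comap T.domain.subtype).map S
  -- A vector v orthogonal to (T + i)D satisfies the weak form of T v = i v, which `hmax` makes a
  -- genuine eigenvalue equation.
  have hR : Dense (R : Set E) := by
    rw [Submodule.dense_iff_topologicalClosure_eq_top,
      Submodule.topologicalClosure_eq_top_iff, Submodule.eq_bot_iff]
    intro v hv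
    have hv' : ∀ u : T.domain, (u : E) ∈ D →
        inner ℂ (Complex.I • v) (u : E) = inner ℂ v (T u) := by
      intro u hu
      have h := (Submodule.mem_orthogonal' _ _).1 hv (S u) ⟨u, hu, rfl⟩
      rw [hS, inner_add_right, inner_smul_right] at h
      rw [inner_smul_left, Complex.conj_I]
      linear_combination -h
    obtain ⟨hvd, hTv⟩ := hmax v _ hv'
    exact hI ⟨v, hvd⟩ hTv
  -- D is a core: choose u n in D with (T + i)(u n) → (T + i) f. The lower bound for T + i makes u n
  -- Cauchy, and its limit is f because -i is not an eigenvalue.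
  have happrox : ∀ f : T.domain, ∃ u : ℕ → T.domain, (∀ n, (u n : E) ∈ D) ∧
      Tendsto (fun n => (u n : E)) atTop (𝓝 f) ∧ Tendsto (fun n => T (u n)) atTop (𝓝 (T f)) := by
    intro f
    obtain ⟨s, hsR, hs⟩ := mem_closure_iff_seq_limit.1 (hR (S f))
    choose u huD hu using hsR
    have huD' : ∀ n, (u n : E) ∈ D := huD
    have hcau : CauchySeq fun n => (u n : E) := by
      rw [Metric.cauchySeq_iff']
      intro ε hε
      obtain ⟨N, hN⟩ := Metric.cauchySeq_iff'.1 hs.cauchySeq ε hε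
      refine ⟨N, fun n hn => ?_⟩
      refine lt_of_le_of_lt ?_ (hN n hn)
      rw [dist_eq_norm, dist_eq_norm, ← hu, ← hu, ← LinearMap.map_sub S, hS]
      exact LinearPMap.norm_le_norm_add_I_smul
        (hsymm (u n - u N) (u n - u N) (D.sub_mem (huD' n) (huD' N)))
    obtain ⟨f', hf'⟩ := cauchySeq_tendsto_of_complete hcau
    have hT : Tendsto (fun n => T (u n)) atTop (𝓝 (S f - Complex.I • f')) := by
      refine (hs.sub (hf'.const_smul Complex.I)).congr fun n => ?_
      rw [← hu, hS, add_sub_cancel_right]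
    obtain ⟨hfd, hTf⟩ := hclosed u f' _ hf' hT
    have hzero : ((f - ⟨f', hfd⟩ : T.domain) : E) = 0 := by
      refine hnegI _ ?_
      rw [LinearPMap.map_sub, hTf, hS, Submodule.coe_sub, smul_sub, neg_smul, neg_smul]
      abel
    have hff : (f : E) = f' := sub_eq_zero.1 hzero
    refine ⟨u, huD', hff ▸ hf', ?_⟩
    rwa [hS, hff, add_sub_cancel_right] at hT
  have hform : T.IsFormalAdjoint T := by
    intro f g
    obtain ⟨u, huD, hu, hTu⟩ := happrox g
    refine tendsto_nhds_unique (tendsto_const_nhds.inner hu) ?_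
    simpa only [hsymm f _ (huD _)] using (tendsto_const_nhds (x := (f : E))).inner hTu
  have hle : T.adjoint ≤ T := by
    refine ⟨fun f hf => ?_, fun f g hfg => ?_⟩
    · exact (hmax f (T.adjoint ⟨f, hf⟩) fun u _ =>
        LinearPMap.adjoint_isFormalAdjoint hTdense ⟨f, hf⟩ u).1
    · obtain ⟨h1, h2⟩ := hmax f (T.adjoint f) fun u _ =>
        LinearPMap.adjoint_isFormalAdjoint hTdense f u
      rw [← h2]
      congr 1
      exact Subtype.ext hfg
  exact le_antisymm hle (hform.le_adjoint hTdense)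

end Hilbert

/-! ### Nonreal numbers are not eigenvalues. -/

/-- A nonreal number is not an eigenvalue of a real multiple of a real dilation. -/
theorem eq_zero_of_comp_dilation {k : ℂ → ℂ} (hk : Differentiable ℂ k) {A c : ℝ} {ε : ℂ}
    (hε : ε.im ≠ 0) (h : ∀ u, c * k (A * u) = ε * k u) (u : ℂ) : k u = 0 := by
  have hd : ∀ n, iteratedDeriv n k 0 = 0 := by
    intro n
    have h1 : (fun u => c * k (A * u)) = fun u => ε * k u := funext h
    have h2 := congrFun (congrArg (iteratedDeriv n) h1) 0
    have h3 : iteratedDeriv n (fun u => k (A * u)) 0 = A ^ n * iteratedDeriv n k 0 := by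
      simpa using congrFun (iteratedDeriv_comp_const_mul (n := n) hk.contDiff (A : ℂ)) 0
    -- The n-th derivatives at 0 give c Aⁿ k⁽ⁿ⁾(0) = ε k⁽ⁿ⁾(0), with c Aⁿ real and ε not.
    rw [iteratedDeriv_const_mul_field, iteratedDeriv_const_mul_field, h3, ← mul_assoc] at h2
    by_contra hne
    have h4 := congrArg Complex.im (mul_right_cancel₀ hne h2)
    rw [← Complex.ofReal_pow, ← Complex.ofReal_mul, Complex.ofReal_im] at h4
    exact hε h4.symm
  rw [← Complex.taylorSeries_eq_of_entire hk 0 u]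
  simp [hd]

namespace FockSpace

theorem eq_zero_of_eigen_of_ne_one (f : FockSpace) {A C : ℝ} {B ε : ℂ} (hA : A ≠ 1)
    (hε : ε.im ≠ 0)
    (h : ∀ z, C * Complex.exp (conj B * z) * f (A * z + B) = ε * f z) : f = 0 := by
  have hA' : (1 - A : ℂ) ≠ 0 := by
    exact_mod_cast sub_ne_zero.2 hA.symm
  -- This is the fixed point of the affine map.
  set p : ℂ := B / (1 - A) with hp
  have hpB : A * p + B = p := by
    rw [hp]; field_simp; ring
  have hpB' : A * conj p + conj B = conj p := by
    simpa using congrArg conj hpB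
  -- Needed so that the constant multiplying the dilation below is real.
  have hreal : conj B * p = ((‖B‖ ^ 2 / (1 - A) : ℝ) : ℂ) := by
    rw [hp, mul_div_assoc', Complex.conj_mul']
    push_cast
    rfl
  -- A Weyl translation to the fixed point, up to a constant; it absorbs the exponential weight.
  set k : ℂ → ℂ := fun u => Complex.exp (-(conj p * u)) * f (p + u) with hk
  have hkd : Differentiable ℂ k := by
    have := f.differentiable
    fun_prop
  have hkeq : ∀ u, ((C * Real.exp (‖B‖ ^ 2 / (1 - A)) : ℝ) : ℂ) * k (A * u) = ε * k u := by
    intro u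
    have h1 := h (p + u)
    rw [show A * (p + u) + B = p + A * u by linear_combination hpB] at h1
    simp only [hk]
    push_cast [← hreal]
    rw [mul_left_comm ε, ← h1]
    have h2 : Complex.exp (conj B * p) * Complex.exp (-(conj p * (A * u))) =
        Complex.exp (-(conj p * u)) * Complex.exp (conj B * (p + u)) := by
      rw [← Complex.exp_add, ← Complex.exp_add]
      congr 1
      linear_combination -u * hpB'
    push_cast [← hreal] at *
    linear_combination C * f (p + A * u) * h2
  ext z
  have h3 := eq_zero_of_comp_dilation hkd hε hkeq (z - p)
  simpa [hk] using h3

theorem eq_zero_of_eigen_translation (f : FockSpace) {C : ℝ} {B ε : ℂ} (hC : C ≠ 0)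
    (hε : ε.im ≠ 0)
    (h : ∀ z, C * Complex.exp (conj B * z) * f (z + B) = ε * f z) : f = 0 := by
  have hC' : (C : ℂ) ≠ 0 := by exact_mod_cast hC
  have hε0 : ε ≠ 0 := fun h0 => hε (by simp [h0])
  by_cases hB : B = 0
  · ext z
    have h1 := h z
    simp only [hB, map_zero, zero_mul, Complex.exp_zero, mul_one, add_zero] at h1
    by_contra hne
    have h2 := congrArg Complex.im (mul_right_cancel₀ hne h1)
    exact hε (by simpa using h2.symm)
  -- Chosen so that the multiplier ε r of `H` under u ↦ u + 1 has modulus one.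
  set c : ℝ := Real.log (‖ε / C‖ * Real.exp (‖B‖ ^ 2 / 2)) with hc
  have hexpc : Real.exp c = ‖ε / C‖ * Real.exp (‖B‖ ^ 2 / 2) :=
    Real.exp_log (mul_pos (norm_pos_iff.2 (div_ne_zero hε0 hC')) (Real.exp_pos _))
  set r : ℝ := Real.exp (‖B‖ ^ 2 / 2 - c) / C with hr
  have hr0 : r ≠ 0 := div_ne_zero (Real.exp_pos _).ne' hC
  -- In the coordinate z = B u the translation is by 1. The quadratic exponent cancels the weight
  -- exp(conj B z) and the linear one normalises the multiplier.
  set H : ℂ → ℂ := fun u => f (B * u) * Complex.exp (‖B‖ ^ 2 * u ^ 2 / 2 - c * u) with hH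
  have hHd : Differentiable ℂ H := by
    have := f.differentiable
    fun_prop
  have hstep : ∀ u, H (u + 1) = ε * r * H u := by
    intro u
    have h1 := h (B * u)
    rw [← mul_assoc, Complex.conj_mul'] at h1
    have h2 : Complex.exp (‖B‖ ^ 2 * (u + 1) ^ 2 / 2 - c * (u + 1)) =
        Complex.exp (‖B‖ ^ 2 * u) * Complex.exp (‖B‖ ^ 2 / 2 - c) *
          Complex.exp (‖B‖ ^ 2 * u ^ 2 / 2 - c * u) := by
      rw [← Complex.exp_add, ← Complex.exp_add]
      congr 1
      ring
    have h3 : (r : ℂ) * C = Complex.exp (‖B‖ ^ 2 / 2 - c) := by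
      rw [hr]
      push_cast
      field_simp
    simp only [hH]
    rw [h2, ← h3, mul_add, mul_one]
    linear_combination (r * Complex.exp (‖B‖ ^ 2 * u ^ 2 / 2 - c * u)) * h1
  have hτ : ‖ε * r‖ = 1 := by
    rw [norm_mul, Complex.norm_real, hr, norm_div, Real.exp_sub, hexpc, norm_div, norm_div,
      norm_mul, norm_div, Complex.norm_real]
    have h1 : ‖ε‖ ≠ 0 := norm_ne_zero_iff.2 hε0
    have h2 : ‖C‖ ≠ 0 := norm_ne_zero_iff.2 hC
    rw [Real.norm_of_nonneg (Real.exp_pos (‖B‖ ^ 2 / 2)).le, norm_norm, norm_norm]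
    field_simp
  have hper : Function.Periodic (fun u : ℂ => ‖H u‖) 1 := fun u => by
    simp only [hstep, norm_mul, hτ, one_mul]
  -- The growth of f contributes |B|²(x² + y²)/2 to the exponent and the Gaussian |B|²(x² - y²)/2,
  -- where u = x + iy, so y drops out.
  have hstrip : ∀ u : ℂ, 0 ≤ u.re → u.re ≤ 1 → ‖H u‖ ≤ Real.exp (‖B‖ ^ 2 + |c|) * ‖f‖ := by
    intro u h0 h1
    have h2 := norm_apply_le_exp f (B * u)
    have h3 : ‖Complex.exp (‖B‖ ^ 2 * u ^ 2 / 2 - c * u)‖ =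
        Real.exp (‖B‖ ^ 2 * (u.re ^ 2 - u.im ^ 2) / 2 - c * u.re) := by
      rw [Complex.norm_exp]
      congr 1
      rw [show (‖B‖ ^ 2 * u ^ 2 / 2 - c * u : ℂ) =
        ((‖B‖ ^ 2 / 2 : ℝ) : ℂ) * u ^ 2 - c * u by push_cast; ring]
      rw [Complex.sub_re, Complex.re_ofReal_mul, Complex.re_ofReal_mul, pow_two u,
        Complex.mul_re]
      ring
    simp only [hH]
    rw [norm_mul, h3]
    refine (mul_le_mul_of_nonneg_right h2 (Real.exp_pos _).le).trans ?_
    rw [mul_right_comm, ← Real.exp_add]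
    refine mul_le_mul_of_nonneg_right (Real.exp_le_exp.2 ?_) (norm_nonneg _)
    have h4 : ‖B * u‖ ^ 2 = ‖B‖ ^ 2 * (u.re ^ 2 + u.im ^ 2) := by
      rw [norm_mul, mul_pow, ← Complex.normSq_eq_norm_sq u, Complex.normSq_apply]
      ring
    rw [h4]
    have h5 : ‖B‖ ^ 2 * u.re ^ 2 ≤ ‖B‖ ^ 2 * 1 :=
      mul_le_mul_of_nonneg_left (by nlinarith) (by positivity)
    have h6 : -c * u.re ≤ |c| * 1 :=
      (mul_le_mul_of_nonneg_right (neg_le_abs c) h0).trans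
        (mul_le_mul_of_nonneg_left h1 (abs_nonneg c))
    linarith
  have hbdd : Bornology.IsBounded (Set.range H) := by
    rw [isBounded_iff_forall_norm_le]
    refine ⟨Real.exp (‖B‖ ^ 2 + |c|) * ‖f‖, ?_⟩
    rintro _ ⟨u, rfl⟩
    have h1 : ‖H (u - ⌊u.re⌋)‖ = ‖H u‖ := by
      simpa using hper.sub_zsmul_eq (x := u) ⌊u.re⌋
    rw [← h1]
    refine hstrip _ ?_ ?_
    · simp
    · simpa using (Int.fract_lt_one u.re).le
  -- By Liouville `H` is constant; were it nonzero, then ε r = 1, impossible for r real and nonzero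
  -- and ε nonreal.
  have hzero : ∀ u, H u = 0 := by
    intro u
    have h1 := hstep u
    rw [hHd.apply_eq_apply_of_bounded hbdd (u + 1) u] at h1
    by_contra hne
    have h2 : (1 : ℂ) = ε * r := mul_right_cancel₀ hne (by rw [one_mul]; exact h1)
    have h3 := congrArg Complex.im h2
    rw [Complex.im_mul_ofReal, Complex.one_im] at h3
    exact mul_ne_zero hε hr0 h3.symm
  ext z
  have h1 := hzero (z / B)
  simp only [hH, mul_div_cancel₀ z hB] at h1
  simpa [mul_div_cancel₀, hB] using h1

end FockSpace

/-! ### Weighted composition operators on the kernels, and the symbols. -/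

section WeightedComp

variable {ψ φ : ℂ → ℂ}

open FockSpace

/-- The condition on the symbols for which the weighted composition operator and its adjoint agree
on the reproducing kernels. -/
def KernelSymmetric (ψ φ : ℂ → ℂ) : Prop :=
  ∀ w z, ψ z * Complex.exp (conj w * φ z) = conj (ψ w) * Complex.exp (conj (φ w) * z)

theorem maximalWeightedComp_apply (f : (maximalWeightedComp ψ φ).domain) (z : ℂ) :
    maximalWeightedComp ψ φ f z = ψ z * (f : FockSpace) (φ z) := rfl

theorem mem_maximalWeightedComp_domain {f g : FockSpace} (h : ∀ z, ψ z * f (φ z) = g z) :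
    ∃ hf : f ∈ (maximalWeightedComp ψ φ).domain, maximalWeightedComp ψ φ ⟨f, hf⟩ = g := by
  have hf : f ∈ (maximalWeightedComp ψ φ).domain := by
    change (fun z => ψ z * f (φ z)) ∈ fockSubmodule
    rw [funext h]
    exact g.2
  exact ⟨hf, ext h⟩

theorem KernelSymmetric.maximalWeightedComp_kernel (h : KernelSymmetric ψ φ) (w : ℂ) :
    ∃ hw : kernel w ∈ (maximalWeightedComp ψ φ).domain,
      maximalWeightedComp ψ φ ⟨kernel w, hw⟩ = conj (ψ w) • kernel (φ w) :=
  mem_maximalWeightedComp_domain fun z => by simpa using h w z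

theorem KernelSymmetric.kernelSpan_le_domain (h : KernelSymmetric ψ φ) :
    kernelSpan ≤ (maximalWeightedComp ψ φ).domain := by
  rw [kernelSpan, Submodule.span_le]
  rintro _ ⟨w, rfl⟩
  exact (h.maximalWeightedComp_kernel w).1

/-- For u = K_w both sides are the conjugate of ψ(w) f(φ(w)); linearity in u does the rest. Leaving
f arbitrary in the domain is what makes the maximal operator contained in the adjoint of its
restriction to the kernels. -/
theorem KernelSymmetric.inner_maximalWeightedComp (h : KernelSymmetric ψ φ)
    (f u : (maximalWeightedComp ψ φ).domain) (hu : (u : FockSpace) ∈ kernelSpan) :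
    inner ℂ (maximalWeightedComp ψ φ f) (u : FockSpace) =
      inner ℂ (f : FockSpace) (maximalWeightedComp ψ φ u) := by
  let S : Submodule ℂ (maximalWeightedComp ψ φ).domain :=
    LinearMap.ker ((innerₛₗ ℂ (maximalWeightedComp ψ φ f)).comp
      (maximalWeightedComp ψ φ).domain.subtype -
      (innerₛₗ ℂ (f : FockSpace)).comp (maximalWeightedComp ψ φ).toFun)
  have hle : kernelSpan ≤ S.map (maximalWeightedComp ψ φ).domain.subtype := by
    rw [kernelSpan, Submodule.span_le]
    rintro _ ⟨w, rfl⟩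
    obtain ⟨hw, hWw⟩ := h.maximalWeightedComp_kernel w
    refine ⟨⟨kernel w, hw⟩, ?_, rfl⟩
    change inner ℂ (maximalWeightedComp ψ φ f) (kernel w) -
      inner ℂ (f : FockSpace) (maximalWeightedComp ψ φ ⟨kernel w, hw⟩) = 0
    rw [hWw, inner_smul_right, ← inner_conj_symm, inner_kernel, ← inner_conj_symm (f : FockSpace),
      inner_kernel, maximalWeightedComp_apply, map_mul, sub_self]
  obtain ⟨v, hv, hvu⟩ := hle hu
  rw [Subtype.ext hvu] at hv
  exact sub_eq_zero.1 hv

theorem KernelSymmetric.isHermitianOp (h : KernelSymmetric ψ φ)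
    (hker : ∀ (f : FockSpace) (ε : ℂ), ε.im ≠ 0 → (∀ z, ψ z * f (φ z) = ε * f z) → f = 0) :
    IsHermitianOp (maximalWeightedComp ψ φ) := by
  have hdense := dense_kernelSpan.mono h.kernelSpan_le_domain
  have hadj : (maximalWeightedComp ψ φ).adjoint = maximalWeightedComp ψ φ := by
    refine LinearPMap.adjoint_eq_self_of_core h.kernelSpan_le_domain dense_kernelSpan
      h.inner_maximalWeightedComp (fun f g hfg => mem_maximalWeightedComp_domain fun w => ?_)
      (fun f hf => ?_) (fun f hf => ?_)
    -- Tested on K_w, the weak identity becomes the pointwise one ψ(w) f(φ(w)) = g(w), which is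
    -- membership in the maximal domain.
    · obtain ⟨hw, hWw⟩ := h.maximalWeightedComp_kernel w
      have h1 := congrArg conj (hfg ⟨kernel w, hw⟩ (kernel_mem_kernelSpan w))
      rw [hWw, inner_smul_right, map_mul, inner_conj_symm, inner_conj_symm, inner_kernel,
        inner_kernel, Complex.conj_conj] at h1
      exact h1.symm
    · refine hker f Complex.I (by simp) fun z => ?_
      rw [← maximalWeightedComp_apply, hf, smul_apply]
    · refine hker f (-Complex.I) (by simp) fun z => ?_
      rw [← maximalWeightedComp_apply, hf, smul_apply]
  refine ⟨?_, hdense, hadj⟩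
  have h1 := LinearPMap.adjoint_isClosed hdense
  rwa [hadj] at h1

theorem kernelSymmetric_of_affine {A C : ℝ} {B : ℂ} (hφ : ∀ z, φ z = A * z + B)
    (hψ : ∀ z, ψ z = C * Complex.exp (conj B * z)) : KernelSymmetric ψ φ := by
  intro w z
  rw [hψ, hψ, hφ, hφ, map_mul, ← Complex.exp_conj, Complex.conj_ofReal, mul_assoc, mul_assoc,
    ← Complex.exp_add, ← Complex.exp_add]
  congr 2
  simp
  ring

theorem isHermitianOp_maximalWeightedComp {A C : ℝ} {B : ℂ} (hC : C ≠ 0)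
    (hφ : ∀ z, φ z = A * z + B) (hψ : ∀ z, ψ z = C * Complex.exp (conj B * z)) :
    IsHermitianOp (maximalWeightedComp ψ φ) := by
  refine (kernelSymmetric_of_affine hφ hψ).isHermitianOp fun f ε hε hf => ?_
  simp only [hφ, hψ] at hf
  by_cases hA : A = 1
  · subst hA
    simp only [Complex.ofReal_one, one_mul] at hf
    exact eq_zero_of_eigen_translation f hC hε hf
  · exact eq_zero_of_eigen_of_ne_one f hA hε hf

theorem IsHermitianOp.kernelSymmetric {W : FockSpace →ₗ.[ℂ] FockSpace} (hH : IsHermitianOp W)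
    (hW : IsWeightedComp ψ φ W) : KernelSymmetric ψ φ := by
  obtain ⟨-, hdense, hadj⟩ := hH
  have happly : ∀ (f : W.domain) (z : ℂ), W f z = ψ z * (f : FockSpace) (φ z) := fun f z => by
    rw [hW.2 (y := ⟨f, hW.1 f.2⟩) rfl, maximalWeightedComp_apply]
  intro w z
  have hinner : ∀ f : W.domain, inner ℂ (conj (ψ w) • kernel (φ w)) (f : FockSpace) =
      inner ℂ (kernel w) (W f) := fun f => by
    rw [inner_smul_left, inner_kernel, inner_kernel, happly, Complex.conj_conj]
  have hmem : kernel w ∈ W.adjoint.domain :=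
    LinearPMap.mem_adjoint_domain_of_exists _ ⟨_, hinner⟩
  have h1 : W.adjoint ⟨kernel w, hmem⟩ = conj (ψ w) • kernel (φ w) :=
    LinearPMap.adjoint_apply_eq hdense _ hinner
  have h2 : W.adjoint ⟨kernel w, hmem⟩ = W ⟨kernel w, hadj ▸ hmem⟩ :=
    hadj.le.2 rfl
  have h3 := congrArg (fun g : FockSpace => g z) (h2.symm.trans h1)
  simpa [happly] using h3

theorem KernelSymmetric.exists_affine (h : KernelSymmetric ψ φ) (hφd : Differentiable ℂ φ)
    (hψ0 : ψ ≠ 0) :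
    ∃ (A C : ℝ) (B : ℂ), C ≠ 0 ∧ (∀ z, φ z = A * z + B) ∧
      ∀ z, ψ z = C * Complex.exp (conj B * z) := by
  have h0 : ∀ z, ψ z = conj (ψ 0) * Complex.exp (conj (φ 0) * z) := fun z => by
    simpa using h 0 z
  obtain ⟨C, hC⟩ : ∃ C : ℝ, ψ 0 = C := by
    obtain ⟨C, hC⟩ := Complex.conj_eq_iff_real.1 (show conj (ψ 0) = ψ 0 by simpa using (h0 0).symm)
    exact ⟨C, hC⟩
  rw [hC, Complex.conj_ofReal] at h0
  set B := φ 0 with hB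
  have hC0 : (C : ℂ) ≠ 0 := fun hzero => hψ0 (funext fun z => by rw [h0, hzero]; simp)
  -- The case w = 1 after cancelling C and the common exponential; differentiating it avoids
  -- choosing a logarithm.
  have hexp : (fun z => Complex.exp (conj B * z + φ z)) =
      fun z => Complex.exp (B + conj (φ 1) * z) := by
    funext z
    have h1 := h 1 z
    rw [h0, h0 1, map_mul, ← Complex.exp_conj, Complex.conj_ofReal, mul_assoc, mul_assoc] at h1
    simpa [Complex.exp_add] using mul_left_cancel₀ hC0 h1
  have hderiv : ∀ z, deriv φ z = conj (φ 1) - conj B := by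
    intro z
    have hl : HasDerivAt (fun z => Complex.exp (conj B * z + φ z))
        (Complex.exp (conj B * z + φ z) * (conj B * 1 + deriv φ z)) z :=
      (((hasDerivAt_id z).const_mul (conj B)).add (hφd z).hasDerivAt).cexp
    have hr : HasDerivAt (fun z => Complex.exp (B + conj (φ 1) * z))
        (Complex.exp (B + conj (φ 1) * z) * (conj (φ 1) * 1)) z :=
      (((hasDerivAt_id z).const_mul (conj (φ 1))).const_add B).cexp
    rw [← hexp] at hr
    have h1 := hl.unique hr
    rw [← congrFun hexp z] at h1
    have h2 := mul_left_cancel₀ (Complex.exp_ne_zero _) h1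
    linear_combination h2
  have haff : ∀ z, φ z = (conj (φ 1) - conj B) * z + B := by
    intro z
    have hd : Differentiable ℂ fun z => φ z - (conj (φ 1) - conj B) * z := by fun_prop
    have hz := is_const_of_deriv_eq_zero hd (fun w => ?_) z 0
    · simp only [mul_zero, sub_zero] at hz
      rw [hB]
      linear_combination hz
    · have h1 := ((hφd w).hasDerivAt.sub ((hasDerivAt_id w).const_mul (conj (φ 1) - conj B))).deriv
      refine Eq.trans h1 ?_
      rw [hderiv]
      ring
  -- At z = 1 the affine formula says that φ(1) - B equals its own conjugate.
  obtain ⟨A, hA⟩ : ∃ A : ℝ, conj (φ 1) - conj B = A := by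
    refine (Complex.conj_eq_iff_real.1 ?_)
    have h1 := haff 1
    rw [map_sub, Complex.conj_conj, Complex.conj_conj]
    linear_combination h1
  refine ⟨A, C, B, by exact_mod_cast hC0, fun z => ?_, h0⟩
  rw [← hA]
  exact haff z

theorem IsHermitianOp.eq_maximalWeightedComp {W : FockSpace →ₗ.[ℂ] FockSpace}
    (hH : IsHermitianOp W) (hW : IsWeightedComp ψ φ W)
    (hM : IsHermitianOp (maximalWeightedComp ψ φ)) : W = maximalWeightedComp ψ φ := by
  refine le_antisymm hW ?_
  have hform : (maximalWeightedComp ψ φ).IsFormalAdjoint (maximalWeightedComp ψ φ) := by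
    have h1 := LinearPMap.adjoint_isFormalAdjoint hM.2.1
    rwa [hM.2.2] at h1
  -- Symmetry of the maximal operator, with one argument restricted to the domain of W, places it
  -- inside the adjoint of W.
  have hform' : W.IsFormalAdjoint (maximalWeightedComp ψ φ) := fun f g => by
    rw [hW.2 (y := ⟨f, hW.1 f.2⟩) rfl]
    exact hform _ g
  calc maximalWeightedComp ψ φ ≤ W.adjoint := hform'.le_adjoint hH.2.1
    _ = W := hH.2.2

end WeightedComp

theorem theorem5p3 (ψ φ : ℂ → ℂ) (hψ : Differentiable ℂ ψ) (hφ : Differentiable ℂ φ)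
    (hψ0 : ψ ≠ 0) (W : FockSpace →ₗ.[ℂ] FockSpace) (hW : IsWeightedComp ψ φ W) :
    IsHermitianOp W ↔
      (W = maximalWeightedComp ψ φ ∧
        ∃ (A C : ℝ) (B : ℂ), C ≠ 0 ∧ (∀ z, φ z = A * z + B) ∧
          ∀ z, ψ z = C * Complex.exp (conj B * z)) := by
  constructor
  · intro hH
    obtain ⟨A, C, B, hC, hφ', hψ'⟩ := (hH.kernelSymmetric hW).exists_affine hφ hψ0
    exact ⟨hH.eq_maximalWeightedComp hW (isHermitianOp_maximalWeightedComp hC hφ' hψ'),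
      A, C, B, hC, hφ', hψ'⟩
  · rintro ⟨rfl, A, C, B, hC, hφ', hψ'⟩
    exact isHermitianOp_maximalWeightedComp hC hφ' hψ'
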